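/- **Definitions.** A *convex set* is a set $X$ with an operation $(x_1,\dots,x_n)\mapsto\sum_i r_i\cdot x_i$ for every finite tuple of non-negative reals $r_1,\dots,r_n$ with $\sum_i r_i=1$, such that $1\cdot x=x$, point masses act as projections, and $\sum_i r_i\cdot(\sum_j s_{ij}\cdot x_j)=\sum_j(\sum_i r_is_{ij})\cdot x_j$; an *affine map* is a map that preserves these operations. A *Kegelspitze* is a convex set $X$ which is also a dcpo (a partially ordered set in which all nonempty directed subsets have suprema) with a least element $\perp$, such that all operations $X^n\to X$ above are Scott-continuous and the scalar multiplication $[0,1]\times X\to X$, $(\lambda,x)\mapsto\lambda\cdot x+(1-\lambda)\cdot\perp$, is Scott-continuous in both arguments. $\mathbf{KS}$ is the category of Kegelspitzen and affine Scott-continuous maps $f$ that are strict ($f(\perp)=\perp$). With the pointwise order on its hom-sets, $\mathbf{KS}$ is enriched over the category $\mathbf{Dcpo}_{\perp !}$ of dcpos with a least element and strict Scott-continuous maps: hom-sets are dcpos with a least element, and composition is strict and Scott-continuous in each argument. The category $|\mathbf{KS}|=\mathbf{KS}^{\mathrm{op}}\times\mathbf{KS}$ is likewise enriched over $\mathbf{Dcpo}_{\perp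 !}$, with $$|\mathbf{KS}|\big((A,B),(A',B')\big)=\mathbf{KS}(A',A)\times\mathbf{KS}(B,B')$$ ordered componentwise. An endofunctor $F$ of a $\mathbf{Dcpo}_{\perp !}$-enriched category $\mathbf C$ is *locally continuous* if every map $F_{X,Y}:\mathbf C(X,Y)\to\mathbf C(FX,FY)$ is Scott-continuous. $\mathbf C$ is *algebraically compact* for a class $\mathcal L$ of endofunctors if every $F\in\mathcal L$ has a fixpoint, i.e. an object $\mu F$ with an isomorphism $e:F(\mu F)\to\mu F$, such that $(\mu F,e)$ is an initial $F$-algebra and $(\mu F,e^{-1})$ is a final $F$-coalgebra. **Corollary.** The category $|\mathbf{KS}|=\mathbf{KS}^{\mathrm{op}}\times\mathbf{KS}$ is algebraically compact for locally continuous endofunctors. -/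

import Mathlib

open CategoryTheory Opposite Convexity

universe u v w

noncomputable section

namespace Kegelspitzen

/-! ### Kegelspitzen -/

/-- Scalar multiplication `r · x = x ⊕_r ⊥ = r x + (1 - r) ⊥` of a convex set with a least element,
for `r` in the real unit interval. -/
def scale {X : Type u} [CompletePartialOrder X] [ConvexSpace ℝ X] (r : unitInterval) (x : X) : X :=
  convexCombPair (r : ℝ) (1 - (r : ℝ)) r.2.1 (sub_nonneg.2 r.2.2) (add_sub_cancel _ _) x ⊥

/-- A Kegelspitze: a dcpo with a least element (Mathlib's `CompletePartialOrder`) carrying a convex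
structure (Mathlib's `ConvexSpace ℝ`) such that every `n`-ary convex combination operation
`Xⁿ → X` is Scott-continuous, and such that the scalar multiplication `[0,1] × X → X`, with the
least element as zero, is Scott-continuous in both arguments. -/
class IsKegelspitze (X : Type u) [CompletePartialOrder X] [ConvexSpace ℝ X] : Prop where
  scottContinuous_iConvexComb (n : ℕ) (r : StdSimplex ℝ (Fin n)) :
    ScottContinuous fun x : Fin n → X => r.iConvexComb x
  scottContinuous_scale_left (x : X) : ScottContinuous fun r : unitInterval => scale r x
  scottContinuous_scale_right (r : unitInterval) : ScottContinuous fun x : X => scale r x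

/-- Objects of the category of Kegelspitzen. -/
structure KS : Type (u + 1) where
  carrier : Type u
  [dcpo : CompletePartialOrder carrier]
  [convex : ConvexSpace ℝ carrier]
  [isKegelspitze : IsKegelspitze carrier]

namespace KS

instance : CoeSort KS.{u} (Type u) := ⟨KS.carrier⟩

attribute [instance] KS.dcpo KS.convex KS.isKegelspitze

/-- Homomorphisms of Kegelspitzen: affine strict Scott-continuous maps. -/
@[ext]
structure Hom (X Y : KS.{u}) : Type u where
  toFun : X → Y
  affine : IsAffineMap ℝ toFun
  strict : toFun ⊥ = ⊥
  scottContinuous : ScottContinuous toFun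

/-- The category `KS` of Kegelspitzen and affine strict Scott-continuous maps. -/
instance : Category.{u} KS.{u} where
  Hom X Y := Hom X Y
  id X := ⟨id, IsAffineMap.id, rfl, ScottContinuous.id⟩
  comp f g := ⟨g.toFun ∘ f.toFun, g.affine.comp f.affine,
    (congrArg g.toFun f.strict).trans g.strict, f.scottContinuous.comp g.scottContinuous⟩

@[ext]
theorem hom_ext {X Y : KS.{u}} {f g : X ⟶ Y} (h : ∀ x, f.toFun x = g.toFun x) : f = g :=
  Hom.ext (funext h)

/-- Homomorphisms are ordered pointwise. -/
instance (X Y : KS.{u}) : PartialOrder (X ⟶ Y) :=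
  PartialOrder.lift (fun f : X ⟶ Y => f.toFun) fun _ _ h => Hom.ext h

theorem hom_le_iff {X Y : KS.{u}} {f g : X ⟶ Y} : f ≤ g ↔ ∀ x, f.toFun x ≤ g.toFun x :=
  Iff.rfl

/-- The constant homomorphism with value `⊥`. -/
instance (X Y : KS.{u}) : OrderBot (X ⟶ Y) where
  bot := ⟨fun _ => ⊥, IsAffineMap.const ⊥, rfl, ScottContinuous.const ⊥⟩
  bot_le _ := hom_le_iff.2 fun _ => bot_le

theorem bot_apply {X Y : KS.{u}} (x : X) : (⊥ : X ⟶ Y).toFun x = ⊥ := rfl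

theorem exists_fin_simplex {X : Type u} (s : StdSimplex ℝ X) :
    ∃ (n : ℕ) (t : StdSimplex ℝ (Fin n)) (g : Fin n → X), s = t.map g := by
  classical
  let e := s.weights.support.equivFin
  let g : Fin s.weights.support.card → X := fun i => (e.symm i : X)
  have hg : Function.Injective g := Subtype.val_injective.comp e.symm.injective
  have hr : (s.weights.support : Set X) ⊆ Set.range g := fun x hx =>
    ⟨e ⟨x, hx⟩, by simp [g]⟩
  have hm := Finsupp.mapDomain_comapDomain g hg s.weights hr
  refine ⟨_, ⟨s.weights.comapDomain g hg.injOn, fun i => s.nonneg (g i), ?_⟩, g, ?_⟩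
  · have h1 := s.total
    rwa [← hm, Finsupp.sum_mapDomain_index (fun _ => rfl) (fun _ _ _ => rfl)] at h1
  · ext1
    exact hm.symm

/-- Nonempty directed sets of homomorphisms have least upper bounds, computed pointwise. -/
theorem exists_isLUB_hom {X Y : KS.{u}} {S : Set (X ⟶ Y)} (hne : S.Nonempty)
    (hS : DirectedOn (· ≤ ·) S) :
    ∃ h : X ⟶ Y, IsLUB S h ∧ ∀ x, IsLUB ((fun f : X ⟶ Y => f.toFun x) '' S) (h.toFun x) := by
  have hd (x : X) : DirectedOn (· ≤ ·) ((fun f : X ⟶ Y => f.toFun x) '' S) := by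
    rintro _ ⟨f, hf, rfl⟩ _ ⟨g, hg, rfl⟩
    obtain ⟨k, hk, hfk, hgk⟩ := hS f hf g hg
    exact ⟨_, ⟨k, hk, rfl⟩, hfk x, hgk x⟩
  let h₀ : X → Y := fun x => sSup ((fun f : X ⟶ Y => f.toFun x) '' S)
  have hl (x : X) : IsLUB ((fun f : X ⟶ Y => f.toFun x) '' S) (h₀ x) := (hd x).isLUB_sSup
  have hsc : ScottContinuous h₀ := by
    intro D hDne hD a ha
    refine ⟨?_, fun b hb => (hl a).2 ?_⟩
    · rintro _ ⟨d, hdD, rfl⟩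
      refine (hl d).2 ?_
      rintro _ ⟨f, hf, rfl⟩
      exact (f.scottContinuous.monotone (ha.1 hdD)).trans ((hl a).1 ⟨f, hf, rfl⟩)
    · rintro _ ⟨f, hf, rfl⟩
      refine (f.scottContinuous hDne hD ha).2 ?_
      rintro _ ⟨d, hdD, rfl⟩
      exact ((hl d).1 ⟨f, hf, rfl⟩).trans (hb ⟨d, hdD, rfl⟩)
  have hstr : h₀ ⊥ = ⊥ := by
    refine le_bot_iff.1 ((hl ⊥).2 ?_)
    rintro _ ⟨f, _, rfl⟩
    exact f.strict.le
  have haff : IsAffineMap ℝ h₀ := by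
    refine ⟨fun s => ?_⟩
    obtain ⟨n, t, g, rfl⟩ := exists_fin_simplex s
    rw [StdSimplex.map_map]
    change h₀ (t.iConvexComb g) = t.iConvexComb fun i => h₀ (g i)
    refine (hl _).unique ?_
    have key : IsLUB ((fun f : X ⟶ Y => fun i => f.toFun (g i)) '' S) (fun i => h₀ (g i)) := by
      rw [isLUB_pi]
      intro i
      rw [Set.image_image]
      exact hl (g i)
    have hdir : DirectedOn (· ≤ ·) ((fun f : X ⟶ Y => fun i => f.toFun (g i)) '' S) := by
      rintro _ ⟨f, hf, rfl⟩ _ ⟨k, hk, rfl⟩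
      obtain ⟨m, hm, hfm, hkm⟩ := hS f hf k hk
      exact ⟨_, ⟨m, hm, rfl⟩, fun i => hfm (g i), fun i => hkm (g i)⟩
    have := IsKegelspitze.scottContinuous_iConvexComb n t (hne.image _) hdir key
    rw [Set.image_image] at this
    have he : (fun f : X ⟶ Y => f.toFun (t.iConvexComb g)) =
        fun f => t.iConvexComb fun i => f.toFun (g i) :=
      funext fun f => f.affine.map_iConvexComb t g
    rw [he]
    exact this
  exact ⟨⟨h₀, haff, hstr, hsc⟩, ⟨fun f hf x => (hl x).1 ⟨f, hf, rfl⟩, fun k hk x => (hl x).2 (by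
    rintro _ ⟨f, hf, rfl⟩
    exact hk hf x)⟩, hl⟩

end KS

/-! ### Categories enriched over pointed dcpos -/

/-- A `Dcpo_{⊥!}`-enriched category: hom-sets are dcpos with a least element, and composition is
strict and Scott-continuous in each argument. -/
class DcpoCategory (C : Type u) [Category.{v} C] where
  homDcpo (X Y : C) : CompletePartialOrder (X ⟶ Y)
  scottContinuous_precomp {X Y : C} (f : X ⟶ Y) (Z : C) :
    ScottContinuous fun g : Y ⟶ Z => f ≫ g
  scottContinuous_postcomp (X : C) {Y Z : C} (g : Y ⟶ Z) :
    ScottContinuous fun f : X ⟶ Y => f ≫ g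
  comp_bot {X Y : C} (f : X ⟶ Y) (Z : C) : f ≫ (⊥ : Y ⟶ Z) = ⊥
  bot_comp (X : C) {Y Z : C} (g : Y ⟶ Z) : (⊥ : X ⟶ Y) ≫ g = ⊥

attribute [reducible, instance] DcpoCategory.homDcpo

/-- A partial order with a least element in which every nonempty directed set has a least upper
bound is a `CompletePartialOrder`; the order and the least element are unchanged, and the value of
`sSup` on sets that are not directed is irrelevant. -/
@[reducible]
def completePartialOrderOfExists (α : Type u) [PartialOrder α] [OrderBot α]
    (h : ∀ S : Set α, S.Nonempty → DirectedOn (· ≤ ·) S → ∃ a, IsLUB S a) :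
    CompletePartialOrder α :=
  open scoped Classical in
  { sSup := fun S => if hS : ∃ a, IsLUB S a then hS.choose else ⊥
    lubOfDirected := fun S hS => by
      have hex : ∃ a, IsLUB S a := by
        rcases S.eq_empty_or_nonempty with rfl | hne
        · exact ⟨⊥, isLUB_empty⟩
        · exact h S hne hS
      simpa only [dif_pos hex] using hex.choose_spec }

/-- `KS` with the pointwise order on homomorphisms. -/
instance : DcpoCategory KS.{u} where
  homDcpo X Y := completePartialOrderOfExists (X ⟶ Y) fun _ hne hS =>
    (KS.exists_isLUB_hom hne hS).imp fun _ h => h.1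
  scottContinuous_precomp {X Y} f Z S hne hS a ha := by
    obtain ⟨k, hk, hkx⟩ := KS.exists_isLUB_hom hne hS
    obtain rfl := hk.unique ha
    refine ⟨?_, fun b hb x => (hkx (f.toFun x)).2 ?_⟩
    · rintro _ ⟨g, hg, rfl⟩ x
      exact hk.1 hg (f.toFun x)
    · rintro _ ⟨g, hg, rfl⟩
      exact hb ⟨g, hg, rfl⟩ x
  scottContinuous_postcomp X {Y Z} g S hne hS a ha := by
    obtain ⟨k, hk, hkx⟩ := KS.exists_isLUB_hom hne hS
    obtain rfl := hk.unique ha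
    refine ⟨?_, fun b hb x => ?_⟩
    · rintro _ ⟨f, hf, rfl⟩ x
      exact g.scottContinuous.monotone (hk.1 hf x)
    · have hd : DirectedOn (· ≤ ·) ((fun f : X ⟶ Y => f.toFun x) '' S) := by
        rintro _ ⟨f, hf, rfl⟩ _ ⟨l, hl, rfl⟩
        obtain ⟨m, hm, hfm, hlm⟩ := hS f hf l hl
        exact ⟨_, ⟨m, hm, rfl⟩, hfm x, hlm x⟩
      refine (g.scottContinuous (hne.image _) hd (hkx x)).2 ?_
      rintro _ ⟨_, ⟨f, hf, rfl⟩, rfl⟩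
      exact hb ⟨f, hf, rfl⟩ x
  comp_bot _ _ := rfl
  bot_comp X {Y Z} g := KS.hom_ext fun _ => g.strict

/-- The order on morphisms of the opposite category: `f ≤ g` means `f.unop ≤ g.unop`. -/
@[reducible]
def opHomDcpo {C : Type u} [Category.{v} C] [DcpoCategory C] (X Y : Cᵒᵖ) :
    CompletePartialOrder (X ⟶ Y) :=
  { le := fun f g => f.unop ≤ g.unop
    le_refl := fun f => le_refl f.unop
    le_trans := fun _ _ _ h h' => le_trans (α := Y.unop ⟶ X.unop) h h'
    le_antisymm := fun _ _ h h' =>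
      Quiver.Hom.unop_inj (le_antisymm (α := Y.unop ⟶ X.unop) h h')
    sSup := fun S => (sSup {f : Y.unop ⟶ X.unop | f.op ∈ S}).op
    bot := (⊥ : Y.unop ⟶ X.unop).op
    bot_le := fun f => bot_le (a := f.unop)
    lubOfDirected := fun S hS => by
      have hS' : DirectedOn (· ≤ ·) {f : Y.unop ⟶ X.unop | f.op ∈ S} := fun f hf g hg => by
        obtain ⟨k, hk, h⟩ := hS f.op hf g.op hg
        exact ⟨k.unop, hk, h⟩
      have h := hS'.isLUB_sSup
      exact ⟨fun f hf => h.1 (show f.unop ∈ {f : Y.unop ⟶ X.unop | f.op ∈ S} from hf),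
        fun b hb => h.2 (show b.unop ∈ upperBounds {f : Y.unop ⟶ X.unop | f.op ∈ S} from
          fun f hf => hb (show f.op ∈ S from hf))⟩ }

/-- The opposite category, with the same order on morphisms. -/
instance (C : Type u) [Category.{v} C] [DcpoCategory C] : DcpoCategory Cᵒᵖ where
  homDcpo := opHomDcpo
  scottContinuous_precomp {X Y} f Z S hne hS a ha := by
    let _ := opHomDcpo (C := C)
    let S' : Set (Z.unop ⟶ Y.unop) := {k | k.op ∈ S}
    have hne' : S'.Nonempty := by
      obtain ⟨k, hk⟩ := hne
      exact ⟨k.unop, hk⟩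
    have hS' : DirectedOn (· ≤ ·) S' := fun k hk l hl => by
      obtain ⟨m, hm, h⟩ := hS k.op hk l.op hl
      exact ⟨m.unop, hm, h⟩
    have ha' : IsLUB S' a.unop :=
      ⟨fun k hk => ha.1 (show k.op ∈ S from hk), fun b hb =>
        ha.2 (show b.op ∈ upperBounds S from fun k hk => hb (show k.unop ∈ S' from hk))⟩
    have h := DcpoCategory.scottContinuous_postcomp Z.unop f.unop hne' hS' ha'
    refine ⟨?_, fun b hb => h.2 (show b.unop ∈ upperBounds _ from ?_)⟩
    · rintro _ ⟨k, hk, rfl⟩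
      exact h.1 ⟨k.unop, hk, rfl⟩
    · rintro _ ⟨k, hk, rfl⟩
      exact hb ⟨k.op, hk, rfl⟩
  scottContinuous_postcomp X {Y Z} g S hne hS a ha := by
    let _ := opHomDcpo (C := C)
    let S' : Set (Y.unop ⟶ X.unop) := {k | k.op ∈ S}
    have hne' : S'.Nonempty := by
      obtain ⟨k, hk⟩ := hne
      exact ⟨k.unop, hk⟩
    have hS' : DirectedOn (· ≤ ·) S' := fun k hk l hl => by
      obtain ⟨m, hm, h⟩ := hS k.op hk l.op hl
      exact ⟨m.unop, hm, h⟩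
    have ha' : IsLUB S' a.unop :=
      ⟨fun k hk => ha.1 (show k.op ∈ S from hk), fun b hb =>
        ha.2 (show b.op ∈ upperBounds S from fun k hk => hb (show k.unop ∈ S' from hk))⟩
    have h := DcpoCategory.scottContinuous_precomp g.unop X.unop hne' hS' ha'
    refine ⟨?_, fun b hb => h.2 (show b.unop ∈ upperBounds _ from ?_)⟩
    · rintro _ ⟨k, hk, rfl⟩
      exact h.1 ⟨k.unop, hk, rfl⟩
    · rintro _ ⟨k, hk, rfl⟩
      exact hb ⟨k.op, hk, rfl⟩
  comp_bot {X Y} f Z := congrArg Quiver.Hom.op (DcpoCategory.bot_comp Z.unop f.unop)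
  bot_comp X {Y Z} g := congrArg Quiver.Hom.op (DcpoCategory.comp_bot g.unop X.unop)

/-- The product of two pointed dcpos, with the componentwise order. -/
@[reducible]
def prodDcpo (α : Type u) (β : Type v) [CompletePartialOrder α] [CompletePartialOrder β] :
    CompletePartialOrder (α × β) :=
  { (inferInstance : PartialOrder (α × β)), (inferInstance : OrderBot (α × β)) with
    sSup := fun S => (sSup (Prod.fst '' S), sSup (Prod.snd '' S))
    lubOfDirected := fun _ hS => isLUB_prod.2 ⟨hS.fst.isLUB_sSup, hS.snd.isLUB_sSup⟩ }

/-- The product category, with the componentwise order on morphisms. -/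
instance (C : Type u) (D : Type w) [Category.{v} C] [Category.{v} D] [DcpoCategory C]
    [DcpoCategory D] : DcpoCategory (C × D) where
  homDcpo X Y := prodDcpo (X.1 ⟶ Y.1) (X.2 ⟶ Y.2)
  scottContinuous_precomp f Z :=
    ScottContinuous.prod (DcpoCategory.scottContinuous_precomp f.1 Z.1)
      (DcpoCategory.scottContinuous_precomp f.2 Z.2)
  scottContinuous_postcomp X _ _ g :=
    ScottContinuous.prod (DcpoCategory.scottContinuous_postcomp X.1 g.1)
      (DcpoCategory.scottContinuous_postcomp X.2 g.2)
  comp_bot f Z := Prod.ext (DcpoCategory.comp_bot f.1 Z.1) (DcpoCategory.comp_bot f.2 Z.2)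
  bot_comp X _ _ g := Prod.ext (DcpoCategory.bot_comp X.1 g.1) (DcpoCategory.bot_comp X.2 g.2)

/-! ### Locally continuous endofunctors and algebraic compactness -/

/-- A functor between `Dcpo_{⊥!}`-enriched categories is locally continuous if all its maps
`C(X, Y) → D(FX, FY)` are Scott-continuous. -/
def LocallyContinuous {C : Type u} {D : Type w} [Category.{v} C] [Category.{v} D]
    [DcpoCategory C] [DcpoCategory D] (F : C ⥤ D) : Prop :=
  ∀ X Y : C, ScottContinuous fun f : X ⟶ Y => F.map f

/-- `C` is algebraically compact for the class `L` of endofunctors: every `F` in `L` has a fixpoint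
`e : F μF ≅ μF` such that `(μF, e)` is an initial `F`-algebra and `(μF, e⁻¹)` is a final
`F`-coalgebra. -/
def AlgebraicallyCompactFor (C : Type u) [Category.{v} C] (L : Set (C ⥤ C)) : Prop :=
  ∀ F ∈ L, ∃ (μF : C) (e : F.obj μF ≅ μF),
    Nonempty (Limits.IsInitial (Endofunctor.Algebra.mk (F := F) μF e.hom)) ∧
    Nonempty (Limits.IsTerminal (Endofunctor.Coalgebra.mk (F := F) μF e.inv))

end Kegelspitzen

end

namespace Kegelspitzen

/-! ### Suprema of ω-chains of morphisms -/

section DcpoCategory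

variable {C : Type u} [Category.{v} C] [DcpoCategory C]

/-! The proof is the limit-colimit coincidence for embedding-projection chains. If `𝟙 Z = ⊥`,
strictness of composition makes `Z` both initial and terminal, and the least maps between `Z` and `F
Z` start a chain of embedding-projection pairs on the iterates `Fⁿ Z`. A bilimit of this chain is
specified by equations and the single supremum `sup (π n ≫ ι n) = 𝟙`. That supremum already forces
it to be a colimit along the embeddings (`Bilimit.hom_ext`, `Bilimit.exists_desc`) and, dually, a
limit along the projections.

A locally continuous `F` preserves such data, so it sends the bilimit to a bilimit of the chain
without its first term. The original vertex is one too, and uniqueness of bilimits yields the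
isomorphism `e`. The colimit property makes `e` an initial algebra; the limit property makes its
inverse a final coalgebra.

It remains to build bilimits in `KSᵒᵖ × KS`. The notion is self-dual and componentwise, so `KS`
suffices. There the compatible sequences serve: since the projections are strict, affine and
Scott-continuous, the least element, convex combinations and directed suprema can all be taken
componentwise. -/

theorem comp_le_comp {X Y Z : C} {f f' : X ⟶ Y} {g g' : Y ⟶ Z} (hf : f ≤ f') (hg : g ≤ g') :
    f ≫ g ≤ f' ≫ g' :=
  ((DcpoCategory.scottContinuous_postcomp X g).monotone hf).trans
    ((DcpoCategory.scottContinuous_precomp f' Z).monotone hg)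

theorem isLUB_range_comp_right {X Y Z : C} {f : ℕ → (X ⟶ Y)} {a : X ⟶ Y} (hf : Monotone f)
    (ha : IsLUB (Set.range f) a) (g : Y ⟶ Z) : IsLUB (Set.range fun n => f n ≫ g) (a ≫ g) := by
  have h := DcpoCategory.scottContinuous_postcomp X g (Set.range_nonempty f)
    hf.directed_le.directedOn_range ha
  rwa [← Set.range_comp] at h

theorem isLUB_range_comp_left {X Y Z : C} {f : ℕ → (Y ⟶ Z)} {a : Y ⟶ Z} (hf : Monotone f)
    (ha : IsLUB (Set.range f) a) (g : X ⟶ Y) : IsLUB (Set.range fun n => g ≫ f n) (g ≫ a) := by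
  have h := DcpoCategory.scottContinuous_precomp g Z (Set.range_nonempty f)
    hf.directed_le.directedOn_range ha
  rwa [← Set.range_comp] at h

theorem LocallyContinuous.isLUB_range_map {D : Type w} [Category.{v} D] [DcpoCategory D]
    {F : C ⥤ D} (hF : LocallyContinuous F) {X Y : C} {f : ℕ → (X ⟶ Y)} {a : X ⟶ Y}
    (hf : Monotone f) (ha : IsLUB (Set.range f) a) :
    IsLUB (Set.range fun n => F.map (f n)) (F.map a) := by
  have h := hF X Y (Set.range_nonempty f) hf.directed_le.directedOn_range ha
  rwa [← Set.range_comp] at h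

theorem isLUB_range_add_one {α : Type*} [Preorder α] {f : ℕ → α} {a : α} (hf : Monotone f) :
    IsLUB (Set.range fun n => f (n + 1)) a ↔ IsLUB (Set.range f) a := by
  suffices upperBounds (Set.range fun n => f (n + 1)) = upperBounds (Set.range f) by
    simp only [IsLUB, this]
  ext b
  simp only [mem_upperBounds, Set.forall_mem_range]
  exact ⟨fun h n => (hf n.le_succ).trans (h n), fun h n => h (n + 1)⟩

/-- Passing to the opposite category reverses arrows but not the order on them. This is what makes
bilimits self-dual. -/
theorem isLUB_range_op {X Y : C} {f : ℕ → (X ⟶ Y)} {a : X ⟶ Y} :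
    IsLUB (Set.range fun n => (f n).op) a.op ↔ IsLUB (Set.range f) a := by
  simp only [isLUB_iff_le_iff, mem_upperBounds, Set.forall_mem_range]
  exact ⟨fun h b => h b.op, fun h b => h b.unop⟩

end DcpoCategory

/-! ### Chains of embedding-projection pairs and bilimits -/

/-- An `ω`-chain of embedding-projection pairs. -/
structure EPChain (C : Type u) [Category.{v} C] [DcpoCategory C] where
  obj : ℕ → C
  emb (n : ℕ) : obj n ⟶ obj (n + 1)
  proj (n : ℕ) : obj (n + 1) ⟶ obj n
  emb_proj (n : ℕ) : emb n ≫ proj n = 𝟙 (obj n)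
  proj_emb_le (n : ℕ) : proj n ≫ emb n ≤ 𝟙 (obj (n + 1))

/-- A bilimit of a chain of embedding-projection pairs: compatible families of embeddings into and
projections from a vertex such that the induced idempotents have the identity as supremum. -/
structure Bilimit {C : Type u} [Category.{v} C] [DcpoCategory C] (X : EPChain C) where
  pt : C
  ι (n : ℕ) : X.obj n ⟶ pt
  π (n : ℕ) : pt ⟶ X.obj n
  emb_ι (n : ℕ) : X.emb n ≫ ι (n + 1) = ι n
  π_proj (n : ℕ) : π (n + 1) ≫ X.proj n = π n
  ι_π (n : ℕ) : ι n ≫ π n = 𝟙 (X.obj n)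
  isLUB : IsLUB (Set.range fun n => π n ≫ ι n) (𝟙 pt)

namespace EPChain

variable {C : Type u} [Category.{v} C] [DcpoCategory C] (X : EPChain C)

/-- The chain in the opposite category, with embeddings and projections exchanged. -/
def op : EPChain Cᵒᵖ where
  obj n := .op (X.obj n)
  emb n := (X.proj n).op
  proj n := (X.emb n).op
  emb_proj n := congrArg Quiver.Hom.op (X.emb_proj n)
  proj_emb_le n := X.proj_emb_le n

/-- The chain underlying a chain in the opposite category. -/
def unop (X : EPChain Cᵒᵖ) : EPChain C where
  obj n := (X.obj n).unop
  emb n := (X.proj n).unop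
  proj n := (X.emb n).unop
  emb_proj n := congrArg Quiver.Hom.unop (X.emb_proj n)
  proj_emb_le n := X.proj_emb_le n

/-- The chain without its first term. -/
def shift : EPChain C where
  obj n := X.obj (n + 1)
  emb n := X.emb (n + 1)
  proj n := X.proj (n + 1)
  emb_proj n := X.emb_proj (n + 1)
  proj_emb_le n := X.proj_emb_le (n + 1)

/-- The image of a chain under a locally continuous functor. -/
def map {D : Type w} [Category.{v} D] [DcpoCategory D] (F : C ⥤ D) (hF : LocallyContinuous F) :
    EPChain D where
  obj n := F.obj (X.obj n)
  emb n := F.map (X.emb n)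
  proj n := F.map (X.proj n)
  emb_proj n := by rw [← F.map_comp, X.emb_proj, F.map_id]
  proj_emb_le n := by
    rw [← F.map_comp, ← F.map_id]
    exact (hF _ _).monotone (X.proj_emb_le n)

/-- The first components of a chain in a product category. -/
def fst {D : Type w} [Category.{v} D] [DcpoCategory D] (X : EPChain (C × D)) : EPChain C where
  obj n := (X.obj n).1
  emb n := (X.emb n).1
  proj n := (X.proj n).1
  emb_proj n := congrArg Prod.fst (X.emb_proj n)
  proj_emb_le n := (X.proj_emb_le n).1

/-- The second components of a chain in a product category. -/
def snd {D : Type w} [Category.{v} D] [DcpoCategory D] (X : EPChain (C × D)) : EPChain D where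
  obj n := (X.obj n).2
  emb n := (X.emb n).2
  proj n := (X.proj n).2
  emb_proj n := congrArg Prod.snd (X.emb_proj n)
  proj_emb_le n := (X.proj_emb_le n).2

/-- The composite embedding between two terms of a chain. -/
def embTo {n m : ℕ} (h : n ≤ m) : X.obj n ⟶ X.obj m :=
  (Functor.ofSequence X.emb).map (homOfLE h)

theorem embTo_refl (n : ℕ) : X.embTo (le_refl n) = 𝟙 (X.obj n) :=
  (Functor.ofSequence X.emb).map_id n

theorem embTo_trans {n m k : ℕ} (h : n ≤ m) (h' : m ≤ k) :
    X.embTo h ≫ X.embTo h' = X.embTo (h.trans h') :=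
  ((Functor.ofSequence X.emb).map_comp (homOfLE h) (homOfLE h')).symm

theorem embTo_succ (n : ℕ) : X.embTo n.le_succ = X.emb n :=
  Functor.ofSequence_map_homOfLE_succ X.emb n

/-- The composite projection between two terms of a chain. -/
def projTo {n m : ℕ} (h : n ≤ m) : X.obj m ⟶ X.obj n :=
  (X.op.embTo h).unop

theorem projTo_refl (n : ℕ) : X.projTo (le_refl n) = 𝟙 (X.obj n) :=
  congrArg Quiver.Hom.unop (X.op.embTo_refl n)

theorem projTo_trans {n m k : ℕ} (h : n ≤ m) (h' : m ≤ k) :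
    X.projTo h' ≫ X.projTo h = X.projTo (h.trans h') :=
  congrArg Quiver.Hom.unop (X.op.embTo_trans h h')

theorem projTo_succ (n : ℕ) : X.projTo n.le_succ = X.proj n :=
  congrArg Quiver.Hom.unop (X.op.embTo_succ n)

theorem embTo_projTo {n m : ℕ} (h : n ≤ m) : X.embTo h ≫ X.projTo h = 𝟙 (X.obj n) := by
  induction m, h using Nat.le_induction with
  | base => rw [embTo_refl, projTo_refl, Category.comp_id]
  | succ m h ih =>
    rw [← X.embTo_trans h m.le_succ, ← X.projTo_trans h m.le_succ, embTo_succ, projTo_succ,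
      Category.assoc, ← Category.assoc (X.emb m), X.emb_proj, Category.id_comp, ih]

theorem projTo_embTo_le {n m : ℕ} (h : n ≤ m) : X.projTo h ≫ X.embTo h ≤ 𝟙 (X.obj m) := by
  induction m, h using Nat.le_induction with
  | base => rw [embTo_refl, projTo_refl, Category.comp_id]
  | succ m h ih =>
    rw [← X.embTo_trans h m.le_succ, ← X.projTo_trans h m.le_succ, embTo_succ, projTo_succ]
    calc (X.proj m ≫ X.projTo h) ≫ X.embTo h ≫ X.emb m
        = (X.proj m ≫ X.projTo h ≫ X.embTo h) ≫ X.emb m := by simp only [Category.assoc]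
      _ ≤ (X.proj m ≫ 𝟙 _) ≫ X.emb m := comp_le_comp (comp_le_comp le_rfl ih) le_rfl
      _ = X.proj m ≫ X.emb m := by rw [Category.comp_id]
      _ ≤ 𝟙 _ := X.proj_emb_le m

/-- The canonical morphism between two terms of a chain: up along embeddings, then down along
projections. -/
def trans (n m : ℕ) : X.obj n ⟶ X.obj m :=
  X.embTo (le_max_left n m) ≫ X.projTo (le_max_right n m)

/-- Climbing past the maximum changes nothing: the extra embedding is cancelled by the projection
that follows it. -/
theorem embTo_projTo_eq_trans {n m k : ℕ} (hn : n ≤ k) (hm : m ≤ k) :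
    X.embTo hn ≫ X.projTo hm = X.trans n m := by
  have h := max_le hn hm
  rw [← X.embTo_trans (le_max_left n m) h, ← X.projTo_trans (le_max_right n m) h, Category.assoc,
    ← Category.assoc (X.embTo h), X.embTo_projTo, Category.id_comp, trans]

theorem trans_of_le {n m : ℕ} (h : n ≤ m) : X.trans n m = X.embTo h := by
  rw [← X.embTo_projTo_eq_trans h le_rfl, projTo_refl, Category.comp_id]

theorem trans_of_ge {n m : ℕ} (h : m ≤ n) : X.trans n m = X.projTo h := by
  rw [← X.embTo_projTo_eq_trans le_rfl h, embTo_refl, Category.id_comp]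

theorem trans_self (n : ℕ) : X.trans n n = 𝟙 (X.obj n) := by
  rw [X.trans_of_le le_rfl, embTo_refl]

theorem emb_trans (n m : ℕ) : X.emb n ≫ X.trans (n + 1) m = X.trans n m := by
  rw [trans, ← embTo_succ, ← Category.assoc, embTo_trans, embTo_projTo_eq_trans]

theorem trans_proj (n m : ℕ) : X.trans n (m + 1) ≫ X.proj m = X.trans n m := by
  rw [trans, ← projTo_succ, Category.assoc, projTo_trans, embTo_projTo_eq_trans]

variable {X} in
theorem embTo_comp {A : C} {c : ∀ n, X.obj n ⟶ A} (hc : ∀ n, X.emb n ≫ c (n + 1) = c n)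
    {n m : ℕ} (h : n ≤ m) : X.embTo h ≫ c m = c n := by
  induction m, h using Nat.le_induction with
  | base => rw [embTo_refl, Category.id_comp]
  | succ m h ih => rw [← X.embTo_trans h m.le_succ, embTo_succ, Category.assoc, hc, ih]

variable {X} in
theorem comp_projTo {A : C} {c : ∀ n, A ⟶ X.obj n} (hc : ∀ n, c (n + 1) ≫ X.proj n = c n)
    {n m : ℕ} (h : n ≤ m) : c m ≫ X.projTo h = c n :=
  congrArg Quiver.Hom.unop
    (embTo_comp (X := X.op) (c := fun n => (c n).op) (fun n => congrArg Quiver.Hom.op (hc n)) h)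

end EPChain

/-! ### Limit-colimit coincidence -/

namespace Bilimit

variable {C : Type u} [Category.{v} C] [DcpoCategory C] {X : EPChain C} (B : Bilimit X)

/-- The term at `n` is the term at `n + 1` with `proj n ≫ emb n ≤ 𝟙` inserted in the middle. -/
theorem monotone_π_comp {A : C} {c : ∀ n, X.obj n ⟶ A} (hc : ∀ n, X.emb n ≫ c (n + 1) = c n) :
    Monotone fun n => B.π n ≫ c n := by
  refine monotone_nat_of_le_succ fun n => ?_
  calc B.π n ≫ c n = B.π (n + 1) ≫ (X.proj n ≫ X.emb n) ≫ c (n + 1) := by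
        rw [Category.assoc, hc, ← Category.assoc, B.π_proj]
    _ ≤ B.π (n + 1) ≫ 𝟙 _ ≫ c (n + 1) :=
        comp_le_comp le_rfl (comp_le_comp (X.proj_emb_le n) le_rfl)
    _ = B.π (n + 1) ≫ c (n + 1) := by rw [Category.id_comp]

theorem monotone_π_ι : Monotone fun n => B.π n ≫ B.ι n := B.monotone_π_comp B.emb_ι

/-- The bilimit in the opposite category. -/
def op : Bilimit X.op where
  pt := .op B.pt
  ι n := (B.π n).op
  π n := (B.ι n).op
  emb_ι n := congrArg Quiver.Hom.op (B.π_proj n)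
  π_proj n := congrArg Quiver.Hom.op (B.emb_ι n)
  ι_π n := congrArg Quiver.Hom.op (B.ι_π n)
  isLUB := isLUB_range_op.2 B.isLUB

/-- A bilimit in the opposite category from a bilimit of the unopposed chain. -/
def ofUnop {X : EPChain Cᵒᵖ} (B : Bilimit X.unop) : Bilimit X where
  pt := .op B.pt
  ι n := (B.π n).op
  π n := (B.ι n).op
  emb_ι n := congrArg Quiver.Hom.op (B.π_proj n)
  π_proj n := congrArg Quiver.Hom.op (B.emb_ι n)
  ι_π n := congrArg Quiver.Hom.op (B.ι_π n)
  isLUB := isLUB_range_op.2 B.isLUB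

/-- A bilimit of a chain is a bilimit of its tail. -/
def shift : Bilimit X.shift where
  pt := B.pt
  ι n := B.ι (n + 1)
  π n := B.π (n + 1)
  emb_ι n := B.emb_ι (n + 1)
  π_proj n := B.π_proj (n + 1)
  ι_π n := B.ι_π (n + 1)
  isLUB := (isLUB_range_add_one B.monotone_π_ι).2 B.isLUB

/-- Locally continuous functors preserve bilimits. -/
def map {D : Type w} [Category.{v} D] [DcpoCategory D] (F : C ⥤ D) (hF : LocallyContinuous F) :
    Bilimit (X.map F hF) where
  pt := F.obj B.pt
  ι n := F.map (B.ι n)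
  π n := F.map (B.π n)
  emb_ι n := (F.map_comp _ _).symm.trans (congrArg F.map (B.emb_ι n))
  π_proj n := (F.map_comp _ _).symm.trans (congrArg F.map (B.π_proj n))
  ι_π n := (F.map_comp _ _).symm.trans ((congrArg F.map (B.ι_π n)).trans (F.map_id _))
  isLUB := by
    have h := hF.isLUB_range_map B.monotone_π_ι B.isLUB
    simp only [F.map_comp, F.map_id] at h
    exact h

/-- Bilimits in a product category are computed componentwise. -/
def prod {D : Type w} [Category.{v} D] [DcpoCategory D] {X : EPChain (C × D)}
    (B : Bilimit X.fst) (B' : Bilimit X.snd) : Bilimit X where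
  pt := (B.pt, B'.pt)
  ι n := (B.ι n, B'.ι n)
  π n := (B.π n, B'.π n)
  emb_ι n := Prod.ext (B.emb_ι n) (B'.emb_ι n)
  π_proj n := Prod.ext (B.π_proj n) (B'.π_proj n)
  ι_π n := Prod.ext (B.ι_π n) (B'.ι_π n)
  isLUB := by
    refine isLUB_prod.2 ⟨?_, ?_⟩
    · rw [← Set.range_comp]
      exact B.isLUB
    · rw [← Set.range_comp]
      exact B'.isLUB

theorem ι_π_eq_trans (n m : ℕ) : B.ι n ≫ B.π m = X.trans n m := by
  rw [← EPChain.embTo_comp B.emb_ι (le_max_left n m),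
    ← EPChain.comp_projTo B.π_proj (le_max_right n m), Category.assoc,
    ← Category.assoc (B.ι _), B.ι_π, Category.id_comp, EPChain.trans]

/-- Since `f = 𝟙 ≫ f` is the supremum of `π n ≫ ι n ≫ f`, it is determined by the maps `ι n ≫ f`. -/
theorem hom_ext {A : C} {f g : B.pt ⟶ A} (h : ∀ n, B.ι n ≫ f = B.ι n ≫ g) : f = g := by
  have hf := isLUB_range_comp_right B.monotone_π_ι B.isLUB f
  have hg := isLUB_range_comp_right B.monotone_π_ι B.isLUB g
  simp only [Category.assoc, Category.id_comp, h] at hf hg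
  exact hf.unique hg

/-- The mediating map is the supremum of the increasing sequence `π n ≫ c n`. -/
theorem exists_desc {A : C} {c : ∀ n, X.obj n ⟶ A} (hc : ∀ n, X.emb n ≫ c (n + 1) = c n) :
    ∃ f : B.pt ⟶ A, ∀ n, B.ι n ≫ f = c n := by
  have hm := B.monotone_π_comp hc
  have hl := hm.directed_le.directedOn_range.isLUB_sSup
  refine ⟨_, fun k => (isLUB_range_comp_left hm hl (B.ι k)).unique ?_⟩
  -- After precomposition with `ι k` the sequence is constantly `c k` from index `k` on;
  -- monotonicity bounds the earlier terms.
  have hk {n : ℕ} (h : k ≤ n) : B.ι k ≫ B.π n ≫ c n = c k := by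
    rw [← Category.assoc, B.ι_π_eq_trans, X.trans_of_le h, EPChain.embTo_comp hc]
  refine ⟨?_, fun b hb => (hk le_rfl).symm.le.trans (hb ⟨k, rfl⟩)⟩
  rintro _ ⟨n, rfl⟩
  refine (comp_le_comp le_rfl (hm (le_max_right k n))).trans_eq (hk (le_max_left k n))

theorem hom_ext_π {A : C} {f g : A ⟶ B.pt} (h : ∀ n, f ≫ B.π n = g ≫ B.π n) : f = g :=
  Quiver.Hom.op_inj (B.op.hom_ext fun n => congrArg Quiver.Hom.op (h n))

theorem exists_lift {A : C} {c : ∀ n, A ⟶ X.obj n} (hc : ∀ n, c (n + 1) ≫ X.proj n = c n) :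
    ∃ f : A ⟶ B.pt, ∀ n, f ≫ B.π n = c n := by
  obtain ⟨f, hf⟩ := B.op.exists_desc (c := fun n => (c n).op)
    fun n => congrArg Quiver.Hom.op (hc n)
  exact ⟨f.unop, fun n => congrArg Quiver.Hom.unop (hf n)⟩

/-- Two bilimits of the same chain are isomorphic, compatibly with embeddings and projections. -/
theorem exists_iso (B' : Bilimit X) : ∃ e : B.pt ≅ B'.pt,
    (∀ n, B.ι n ≫ e.hom = B'.ι n) ∧ ∀ n, e.inv ≫ B.π n = B'.π n := by
  obtain ⟨f, hf⟩ := B.exists_desc B'.emb_ι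
  obtain ⟨g, hg⟩ := B'.exists_desc B.emb_ι
  refine ⟨⟨f, g, B.hom_ext fun n => ?_, B'.hom_ext fun n => ?_⟩, hf,
    fun n => B'.hom_ext fun k => ?_⟩
  · rw [← Category.assoc, hf, hg, Category.comp_id]
  · rw [← Category.assoc, hg, hf, Category.comp_id]
  -- Compatibility with projections is automatic: restricted along the embeddings, both sides are
  -- the canonical maps `trans k n`, which depend on the chain alone.
  · rw [← Category.assoc, hg, B.ι_π_eq_trans, B'.ι_π_eq_trans]

end Bilimit

/-! ### Initial algebra and final coalgebra from the chain of iterates -/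

section Iterate

variable {C : Type u} [Category.{v} C] [DcpoCategory C] (F : C ⥤ C) {Z : C}

/-- The iterates of `F` at `Z`. -/
def iterObj (Z : C) : ℕ → C
  | 0 => Z
  | n + 1 => F.obj (iterObj Z n)

/-- The embeddings `Fⁿ Z ⟶ Fⁿ⁺¹ Z` starting from the least morphism. -/
def iterEmb (Z : C) : ∀ n, iterObj F Z n ⟶ iterObj F Z (n + 1)
  | 0 => (⊥ : Z ⟶ F.obj Z)
  | n + 1 => F.map (iterEmb Z n)

/-- The projections `Fⁿ⁺¹ Z ⟶ Fⁿ Z` starting from the least morphism. -/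
def iterProj (Z : C) : ∀ n, iterObj F Z (n + 1) ⟶ iterObj F Z n
  | 0 => (⊥ : F.obj Z ⟶ Z)
  | n + 1 => F.map (iterProj Z n)

variable {F}

/-- The chain of iterates of a locally continuous functor at a zero object. -/
def iterChain (hF : LocallyContinuous F) (hZ : 𝟙 Z = ⊥) : EPChain C where
  obj := iterObj F Z
  emb := iterEmb F Z
  proj := iterProj F Z
  emb_proj n := by
    induction n with
    | zero => exact (DcpoCategory.bot_comp Z _).trans hZ.symm
    | succ n ih => exact (F.map_comp _ _).symm.trans ((congrArg F.map ih).trans (F.map_id _))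
  proj_emb_le n := by
    induction n with
    | zero => exact (DcpoCategory.bot_comp (F.obj Z) (⊥ : Z ⟶ F.obj Z)).trans_le bot_le
    | succ n ih =>
      exact (F.map_comp _ _).symm.trans_le (((hF _ _).monotone ih).trans_eq (F.map_id _))

/-- The cocone over the iterates of `F` induced by an algebra. -/
def iterDesc (Z : C) {A : C} (a : F.obj A ⟶ A) : ∀ n, iterObj F Z n ⟶ A
  | 0 => (⊥ : Z ⟶ A)
  | n + 1 => F.map (iterDesc Z a n) ≫ a

/-- The cone over the iterates of `F` induced by a coalgebra. -/
def iterLift (Z : C) {A : C} (a : A ⟶ F.obj A) : ∀ n, A ⟶ iterObj F Z n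
  | 0 => (⊥ : A ⟶ Z)
  | n + 1 => a ≫ F.map (iterLift Z a n)

theorem iterEmb_iterDesc {A : C} (a : F.obj A ⟶ A) (n : ℕ) :
    iterEmb F Z n ≫ iterDesc Z a (n + 1) = iterDesc Z a n := by
  induction n with
  | zero => exact DcpoCategory.bot_comp Z _
  | succ n ih =>
    change F.map (iterEmb F Z n) ≫ F.map (iterDesc Z a (n + 1)) ≫ a = F.map (iterDesc Z a n) ≫ a
    rw [← Category.assoc, ← F.map_comp, ih]

theorem iterLift_iterProj {A : C} (a : A ⟶ F.obj A) (n : ℕ) :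
    iterLift Z a (n + 1) ≫ iterProj F Z n = iterLift Z a n := by
  induction n with
  | zero => exact DcpoCategory.comp_bot _ Z
  | succ n ih =>
    change (a ≫ F.map (iterLift Z a (n + 1))) ≫ F.map (iterProj F Z n) = a ≫ F.map (iterLift Z a n)
    rw [Category.assoc, ← F.map_comp, ih]

variable (hF : LocallyContinuous F) (hZ : 𝟙 Z = ⊥) (B : Bilimit (iterChain hF hZ))

/-- Existence: the square can be tested on the maps `F.map (B.ι n)`, which are jointly epic because
`F` preserves the bilimit. Uniqueness: restricting any algebra morphism along `ι n` gives a sequence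
obeying the recursion of `iterDesc`. -/
theorem existsUnique_algebraHom {e : F.obj B.pt ⟶ B.pt}
    (he : ∀ n, F.map (B.ι n) ≫ e = B.ι (n + 1)) {A : C} (a : F.obj A ⟶ A) :
    ∃! f : B.pt ⟶ A, F.map f ≫ a = e ≫ f := by
  obtain ⟨f, hf⟩ := B.exists_desc (iterEmb_iterDesc a)
  refine ⟨f, (B.map F hF).hom_ext fun n => ?_, fun g hg => B.hom_ext fun n => ?_⟩
  · have h : F.map (B.ι n) ≫ F.map f ≫ a = F.map (B.ι n ≫ f) ≫ a := by
      rw [F.map_comp, Category.assoc]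
    exact h.trans ((congrArg (fun k => F.map k ≫ a) (hf n)).trans
      ((hf (n + 1)).symm.trans ((congrArg (· ≫ f) (he n).symm).trans (Category.assoc _ _ _))))
  · rw [hf]
    induction n with
    | zero =>
      -- Every map out of the zero object is `⊥`, so the recursion has only one possible start.
      have h : 𝟙 ((iterChain hF hZ).obj 0) = ⊥ := hZ
      rw [← Category.id_comp (B.ι 0 ≫ g), h, DcpoCategory.bot_comp]
      rfl
    | succ n ih =>
      have h : (F.map (B.ι n) ≫ e) ≫ g = F.map (B.ι n ≫ g) ≫ a := by
        rw [Category.assoc, ← hg, F.map_comp, Category.assoc]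
      exact (congrArg (· ≫ g) (he n).symm).trans
        (h.trans (congrArg (fun k => F.map k ≫ a) ih))

/-- The dual argument: the maps `F.map (B.π n)` are jointly monic, and every map into the zero
object is `⊥`. -/
theorem existsUnique_coalgebraHom {e : B.pt ⟶ F.obj B.pt}
    (he : ∀ n, e ≫ F.map (B.π n) = B.π (n + 1)) {A : C} (a : A ⟶ F.obj A) :
    ∃! f : A ⟶ B.pt, a ≫ F.map f = f ≫ e := by
  obtain ⟨f, hf⟩ := B.exists_lift (iterLift_iterProj a)
  refine ⟨f, (B.map F hF).hom_ext_π fun n => ?_, fun g hg => B.hom_ext_π fun n => ?_⟩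
  · have h : (a ≫ F.map f) ≫ F.map (B.π n) = a ≫ F.map (f ≫ B.π n) := by
      rw [F.map_comp, Category.assoc]
    exact h.trans ((congrArg (fun k => a ≫ F.map k) (hf n)).trans
      ((hf (n + 1)).symm.trans
        ((congrArg (f ≫ ·) (he n).symm).trans (Category.assoc _ _ _).symm)))
  · rw [hf]
    induction n with
    | zero =>
      have h : 𝟙 ((iterChain hF hZ).obj 0) = ⊥ := hZ
      rw [← Category.comp_id (g ≫ B.π 0), h, DcpoCategory.comp_bot]
      rfl
    | succ n ih =>
      have h : g ≫ e ≫ F.map (B.π n) = a ≫ F.map (g ≫ B.π n) := by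
        rw [← Category.assoc, ← hg, F.map_comp, Category.assoc]
      exact (congrArg (g ≫ ·) (he n).symm).trans
        (h.trans (congrArg (fun k => a ≫ F.map k) ih))

/-- A category with a zero object and bilimits of all chains of embedding-projection pairs is
algebraically compact for locally continuous endofunctors. -/
theorem algebraicallyCompactFor_locallyContinuous {Z : C} (hZ : 𝟙 Z = ⊥)
    (hC : ∀ X : EPChain C, Nonempty (Bilimit X)) :
    AlgebraicallyCompactFor C {F | LocallyContinuous F} := by
  intro F (hF : LocallyContinuous F)
  obtain ⟨B⟩ := hC (iterChain hF hZ)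
  -- Applying `F` to the chain of iterates gives its tail by definition, so both bilimits are over
  -- the same chain. The one `e` respects embeddings and its inverse respects projections, as the
  -- algebra and coalgebra halves respectively require.
  obtain ⟨e, he, he'⟩ := (B.map F hF).exists_iso (B.shift : Bilimit ((iterChain hF hZ).map F hF))
  have hi := fun A : Endofunctor.Algebra F => existsUnique_algebraHom hF hZ B he A.str
  have ht := fun A : Endofunctor.Coalgebra F =>
    existsUnique_coalgebraHom hF hZ B (e := e.inv) (fun n => ?_) A.str
  · refine ⟨B.pt, e, ⟨.ofUniqueHom (fun A => ⟨(hi A).choose, (hi A).choose_spec.1⟩) fun A m =>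
      Endofunctor.Algebra.ext ((hi A).choose_spec.2 m.f m.h)⟩,
      ⟨.ofUniqueHom (fun A => ⟨(ht A).choose, (ht A).choose_spec.1⟩) fun A m =>
      Endofunctor.Coalgebra.ext ((ht A).choose_spec.2 m.f m.h)⟩⟩
  · exact he' n

end Iterate

end Kegelspitzen

/-! ### Bilimits of Kegelspitzen -/

noncomputable section

namespace Kegelspitzen

namespace KS

variable (X : EPChain KS.{u})

/-- The carrier of the bilimit of a chain of Kegelspitzen: the sequences compatible with the
projections. -/
@[ext]
structure BilimitCarrier : Type u where
  val (n : ℕ) : X.obj n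
  proj_val (n : ℕ) : (X.proj n).toFun (val (n + 1)) = val n

namespace BilimitCarrier

variable {X}

instance : PartialOrder (BilimitCarrier X) :=
  PartialOrder.lift BilimitCarrier.val fun _ _ => BilimitCarrier.ext

instance : OrderBot (BilimitCarrier X) where
  bot := ⟨fun _ => ⊥, fun n => (X.proj n).strict⟩
  bot_le x n := bot_le (a := x.val n)

theorem directedOn_image_val {S : Set (BilimitCarrier X)} (hS : DirectedOn (· ≤ ·) S) (n : ℕ) :
    DirectedOn (· ≤ ·) ((fun x : BilimitCarrier X => x.val n) '' S) := by
  rintro _ ⟨x, hx, rfl⟩ _ ⟨y, hy, rfl⟩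
  obtain ⟨z, hz, hxz, hyz⟩ := hS x hx y hy
  exact ⟨_, ⟨z, hz, rfl⟩, hxz n, hyz n⟩

theorem isLUB_of_isLUB_val {S : Set (BilimitCarrier X)} {a : BilimitCarrier X}
    (h : ∀ n, IsLUB ((fun x : BilimitCarrier X => x.val n) '' S) (a.val n)) : IsLUB S a :=
  ⟨fun x hx n => (h n).1 ⟨x, hx, rfl⟩, fun b hb n => (h n).2 (by
    rintro _ ⟨x, hx, rfl⟩
    exact hb hx n)⟩

/-- Nonempty directed sets of compatible sequences have least upper bounds, computed
componentwise. -/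
theorem exists_isLUB {S : Set (BilimitCarrier X)} (hne : S.Nonempty)
    (hS : DirectedOn (· ≤ ·) S) : ∃ a : BilimitCarrier X, IsLUB S a ∧
      ∀ n, IsLUB ((fun x : BilimitCarrier X => x.val n) '' S) (a.val n) := by
  have hl (n : ℕ) := (directedOn_image_val hS n).isLUB_sSup
  let a : BilimitCarrier X := ⟨fun n => sSup ((fun x : BilimitCarrier X => x.val n) '' S), fun n => by
    -- Scott continuity of the projections is what keeps the componentwise suprema a compatible
    -- sequence.
    have h := (X.proj n).scottContinuous (hne.image _) (directedOn_image_val hS (n + 1)) (hl (n + 1))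
    rw [Set.image_image] at h
    simp only [proj_val] at h
    exact h.unique (hl n)⟩
  exact ⟨a, isLUB_of_isLUB_val hl, hl⟩

instance : CompletePartialOrder (BilimitCarrier X) :=
  completePartialOrderOfExists _ fun _ hne hS => (exists_isLUB hne hS).imp fun _ h => h.1

/-- Suprema are unique, so any given one is the componentwise one. -/
theorem isLUB_val {S : Set (BilimitCarrier X)} (hne : S.Nonempty) (hS : DirectedOn (· ≤ ·) S)
    {a : BilimitCarrier X} (ha : IsLUB S a) (n : ℕ) :
    IsLUB ((fun x : BilimitCarrier X => x.val n) '' S) (a.val n) := by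
  obtain ⟨b, hb, hbn⟩ := exists_isLUB hne hS
  obtain rfl := hb.unique ha
  exact hbn n

theorem scottContinuous_val (n : ℕ) : ScottContinuous fun x : BilimitCarrier X => x.val n :=
  fun _ hne hS _ ha => isLUB_val hne hS ha n

theorem scottContinuous_of_val {α : Type*} [Preorder α] {f : α → BilimitCarrier X}
    (h : ∀ n, ScottContinuous fun a => (f a).val n) : ScottContinuous f := by
  refine fun S hne hS a ha => isLUB_of_isLUB_val fun n => ?_
  rw [Set.image_image]
  exact h n hne hS ha

/-- Convex combinations are computed componentwise. -/
instance : ConvexSpace ℝ (BilimitCarrier X) :=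
  .mk (fun s => ⟨fun n => s.iConvexComb fun x => x.val n, fun n => by
      rw [(X.proj n).affine.map_iConvexComb]
      exact congrArg s.iConvexComb (funext fun x => x.proj_val n)⟩)
    (fun x => BilimitCarrier.ext (funext fun n => iConvexComb_single _ _))
    (fun s => BilimitCarrier.ext (funext fun n => by
      change iConvexComb (s.map _) _ = _
      rw [iConvexComb_map]
      exact (iConvexComb_assoc s id _).trans (by rw [iConvexComb_id])))

theorem isAffineMap_val (n : ℕ) : IsAffineMap ℝ fun x : BilimitCarrier X => x.val n :=
  ⟨fun _ => rfl⟩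

theorem isAffineMap_of_val {M : Type*} [ConvexSpace ℝ M] {f : M → BilimitCarrier X}
    (h : ∀ n, IsAffineMap ℝ fun a => (f a).val n) : IsAffineMap ℝ f :=
  ⟨fun s => BilimitCarrier.ext (funext fun n => ((h n).map_sConvexComb s).trans (by
    rw [(isAffineMap_val n).map_sConvexComb, StdSimplex.map_map]))⟩

theorem scale_val (r : unitInterval) (x : BilimitCarrier X) (n : ℕ) :
    (scale r x).val n = scale r (x.val n) :=
  (isAffineMap_val n).map_convexCombPair _ _ _ x ⊥

instance : IsKegelspitze (BilimitCarrier X) where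
  scottContinuous_iConvexComb k r := by
    refine scottContinuous_of_val fun n => ?_
    have hv : ScottContinuous fun (x : Fin k → BilimitCarrier X) i => (x i).val n := ?_
    · have h := hv.comp (IsKegelspitze.scottContinuous_iConvexComb (X := X.obj n) k r)
      have he : (fun x : Fin k → BilimitCarrier X => (r.iConvexComb x).val n) =
          fun x => r.iConvexComb fun i => (x i).val n :=
        funext fun x => (isAffineMap_val n).map_iConvexComb r x
      rw [he]
      exact h
    · intro S hne hS a ha
      rw [isLUB_pi] at ha ⊢
      intro i
      have hd : DirectedOn (· ≤ ·) (Function.eval i '' S) := by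
        rintro _ ⟨x, hx, rfl⟩ _ ⟨y, hy, rfl⟩
        obtain ⟨z, hz, hxz, hyz⟩ := hS x hx y hy
        exact ⟨_, ⟨z, hz, rfl⟩, hxz i, hyz i⟩
      have h := isLUB_val (hne.image _) hd (ha i) n
      rw [Set.image_image] at h ⊢
      exact h
  scottContinuous_scale_left x := scottContinuous_of_val fun n => by
    simp only [scale_val]
    exact IsKegelspitze.scottContinuous_scale_left (x.val n)
  scottContinuous_scale_right r := scottContinuous_of_val fun n => by
    simp only [scale_val]
    exact (scottContinuous_val n).comp (IsKegelspitze.scottContinuous_scale_right r)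

end BilimitCarrier

theorem comp_apply {X Y Z : KS.{u}} (f : X ⟶ Y) (g : Y ⟶ Z) (x : X) :
    (f ≫ g).toFun x = g.toFun (f.toFun x) := rfl

theorem id_apply {X : KS.{u}} (x : X) : (𝟙 X : X ⟶ X).toFun x = x := rfl

variable {X} in
theorem projTo_apply_val (x : BilimitCarrier X) {n m : ℕ} (h : n ≤ m) :
    (X.projTo h).toFun (x.val m) = x.val n := by
  induction m, h using Nat.le_induction with
  | base => rw [EPChain.projTo_refl, id_apply]
  | succ m h ih =>
    rw [← X.projTo_trans h m.le_succ, EPChain.projTo_succ, comp_apply, x.proj_val m, ih]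

/-- Every chain of embedding-projection pairs of Kegelspitzen has a bilimit. -/
def bilimit : Bilimit X where
  pt := ⟨BilimitCarrier X⟩
  ι n :=
    { toFun x := ⟨fun m => (X.trans n m).toFun x, fun m => by rw [← comp_apply, X.trans_proj]⟩
      affine := BilimitCarrier.isAffineMap_of_val fun m => (X.trans n m).affine
      strict := BilimitCarrier.ext (funext fun m => (X.trans n m).strict)
      scottContinuous :=
        BilimitCarrier.scottContinuous_of_val fun m => (X.trans n m).scottContinuous }
  π n :=
    { toFun x := x.val n
      affine := BilimitCarrier.isAffineMap_val n
      strict := rfl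
      scottContinuous := BilimitCarrier.scottContinuous_val n }
  emb_ι n := hom_ext fun x => BilimitCarrier.ext (funext fun m =>
    congrArg (fun f => Hom.toFun f x) (X.emb_trans n m))
  π_proj n := hom_ext fun x => x.proj_val n
  ι_π n := hom_ext fun x => congrArg (fun f => Hom.toFun f x) (X.trans_self n)
  isLUB := by
    refine ⟨?_, fun f hf x m => ?_⟩
    · rintro _ ⟨n, rfl⟩ x m
      change (X.trans n m).toFun (x.val n) ≤ x.val m
      rcases le_total n m with h | h
      -- Below level `m`, the component `x.val n` is a projection of `x.val m`, and embedding it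
      -- back can only decrease; above level `m`, projecting gives `x.val m` exactly.
      · rw [X.trans_of_le h, ← projTo_apply_val x h]
        exact X.projTo_embTo_le h (x.val m)
      · rw [X.trans_of_ge h, projTo_apply_val]
    -- The `m`-th component of the supremum is already attained at index `n = m`.
    · have h : (X.trans m m).toFun (x.val m) ≤ (f.toFun x).val m := hf ⟨m, rfl⟩ x m
      rwa [X.trans_self, id_apply] at h

instance : ConvexSpace ℝ PUnit.{u + 1} :=
  .mk (fun _ => .unit) (fun _ => rfl) fun _ => rfl

/-- The one-point Kegelspitze. -/
def zero : KS.{u} where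
  carrier := PUnit
  dcpo := completePartialOrderOfExists _ fun _ _ _ => ⟨.unit, fun _ _ => le_rfl, fun _ _ => le_rfl⟩
  isKegelspitze := ⟨fun _ _ => .const _, fun _ => .const _, fun _ => .const _⟩

end KS

end Kegelspitzen

end

theorem mainTheorem7 :
    Kegelspitzen.AlgebraicallyCompactFor (Kegelspitzen.KS.{u}ᵒᵖ × Kegelspitzen.KS.{u})
      {F | Kegelspitzen.LocallyContinuous F} := by
  -- On the one-point Kegelspitze the identity and the least map coincide definitionally, in both
  -- components, hence `rfl`.
  refine Kegelspitzen.algebraicallyCompactFor_locallyContinuous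
    (Z := (op Kegelspitzen.KS.zero, Kegelspitzen.KS.zero)) rfl fun X => ⟨?_⟩
  exact .prod (.ofUnop (Kegelspitzen.KS.bilimit _)) (Kegelspitzen.KS.bilimit _)
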